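/- Let $X$ be a finite set of real-valued random variables. A chain graph (CG) over $X$ is a simple graph with node set $X$ and directed and/or undirected edges that has no semidirected cycle, i.e. no cycle $X_1 \to X_2 \multimap \cdots \multimap X_n = X_1$ where each $\multimap$ is $\to$ or $-$. A route is a sequence of not necessarily distinct nodes in which consecutive nodes are adjacent. An occurrence of a node $X_k$ in a route $\rho$ is a triplex node of $\rho$ if, together with the preceding node $X_j$ and the following node $X_l$ of $\rho$, it forms $X_j \to X_k \leftarrow X_l$, $X_j \to X_k - X_l$ or $X_j - X_k \leftarrow X_l$ (possibly $X_j = X_l$). For $C \subseteq X$, $\rho$ is $C$-open if every triplex node occurrence in $\rho$ is in $C$ and every non-triplex node occurrence in $\rho$ is outside $C$. For pairwise disjoint $A, B, C \subseteq X$, $A$ is separated from $B$ given $C$ in $G$ if there is no $C$-open route in $G$ between a node of $A$ and a node of $B$ (the Andersson-Madigan-Perlman interpretation of CGs). The independences represented by $G$ are the triples $(A,B,C)$ of pairwise disjoint subsets of $X$ such that $A$ is separated from $B$ given $C$ in $G$. A joint probability distribution $p$ of $X$ (a Borel probability measure on $\mathbb{R}^X$) is Markovian with respect to $G$ if, for every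 independence $(A,B,C)$ represented by $G$, the variables in $A$ are, under $p$, conditionally independent of those in $B$ given those in $C$. Two CGs over $X$ are Markov equivalent if the set of distributions that are Markovian with respect to each of them is the same. **Lemma.** Two CGs $G$ and $H$ over $X$ are Markov equivalent if and only if they represent the same independences. -/

import Mathlib

/-- A chain graph on the node set `V`: a simple graph (no loops, at most one edge between any two
nodes) with directed edges `dir x y` (`x → y`) and undirected edges `undir x y` (`x - y`), and
without semidirected cycles. -/
structure ChainGraph (V : Type*) where
  /-- `dir x y` : the directed edge `x → y` is in the graph. -/
  dir : V → V → Prop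
  /-- `undir x y` : the undirected edge `x - y` is in the graph. -/
  undir : V → V → Prop
  undir_symm : ∀ x y, undir x y → undir y x
  undir_irrefl : ∀ x, ¬ undir x x
  dir_irrefl : ∀ x, ¬ dir x x
  dir_asymm : ∀ x y, dir x y → ¬ dir y x
  not_dir_and_undir : ∀ x y, ¬ (dir x y ∧ undir x y)
  /-- There is no cycle that starts with `x → y` and then goes from `y` back to `x` along edges
  each of which is `→` or `-`. -/
  no_semidirected_cycle : ∀ x y, dir x y →
    ¬ Relation.ReflTransGen (fun u v => dir u v ∨ undir u v) y x

namespace ChainGraph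

/-- The underlying simple graph: two nodes are adjacent when there is an edge of any kind
between them. -/
def skeleton {V : Type*} (G : ChainGraph V) : SimpleGraph V where
  Adj x y := G.dir x y ∨ G.dir y x ∨ G.undir x y
  symm := ⟨fun x y h => by
    rcases h with h | h | h
    · exact Or.inr (Or.inl h)
    · exact Or.inl h
    · exact Or.inr (Or.inr (G.undir_symm x y h))⟩
  loopless := ⟨fun x h => by
    rcases h with h | h | h
    · exact G.dir_irrefl x h
    · exact G.dir_irrefl x h
    · exact G.undir_irrefl x h⟩

/-- A route from `a` to `b`: a sequence of not necessarily distinct nodes, consecutive ones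
being adjacent. -/
abbrev Route {V : Type*} (G : ChainGraph V) (a b : V) : Type _ := G.skeleton.Walk a b

/-- `x, y, z` form `x → y ← z`, `x → y - z` or `x - y ← z` (possibly with `x = z`). -/
def TriplexPattern {V : Type*} (G : ChainGraph V) (x y z : V) : Prop :=
  (G.dir x y ∧ G.dir z y) ∨ (G.dir x y ∧ G.undir y z) ∨ (G.undir x y ∧ G.dir z y)

/-- The `i`-th node (counting from `0`) of the route `ρ` is a triplex node at that position: it
is an inner node of the route and together with its two neighbours in `ρ` it forms a triplex
pattern. -/
def IsTriplexAt {V : Type*} (G : ChainGraph V) {a b : V} (ρ : G.Route a b) (i : ℕ) : Prop :=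
  0 < i ∧ i < ρ.length ∧
    G.TriplexPattern (ρ.getVert (i - 1)) (ρ.getVert i) (ρ.getVert (i + 1))

/-- A route is `C`-open when every triplex node in it is in `C` and every non-triplex node in it
is outside `C`; a node that the route visits several times is judged at each of its
occurrences. -/
def IsOpenRoute {V : Type*} (G : ChainGraph V) {a b : V} (ρ : G.Route a b) (C : Set V) : Prop :=
  ∀ i ≤ ρ.length,
    (G.IsTriplexAt ρ i → ρ.getVert i ∈ C) ∧ (¬ G.IsTriplexAt ρ i → ρ.getVert i ∉ C)

/-- `A` is separated from `B` given `C` in `G`. -/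
def Separated {V : Type*} (G : ChainGraph V) (A B C : Set V) : Prop :=
  ∀ a ∈ A, ∀ b ∈ B, ¬ ∃ ρ : G.Route a b, G.IsOpenRoute ρ C

/-- The independences represented by `G`: the triples `(A, B, C)` of (pairwise) disjoint sets of
nodes such that `A` is separated from `B` given `C` in `G`. -/
def independences {V : Type*} (G : ChainGraph V) : Set (Set V × Set V × Set V) :=
  {T | Disjoint T.1 T.2.1 ∧ Disjoint T.1 T.2.2 ∧ Disjoint T.2.1 T.2.2 ∧
    G.Separated T.1 T.2.1 T.2.2}

end ChainGraph

/-- The subvector of the coordinates in `C`. -/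
def coordProj {V : Type*} (C : Set V) (x : V → ℝ) : C → ℝ := fun i => x i

/-- The σ-algebra on `V → ℝ` generated by the coordinates in `C`. -/
@[reducible]
def coordSigma {V : Type*} (C : Set V) : MeasurableSpace (V → ℝ) :=
  MeasurableSpace.comap (coordProj C) inferInstance

lemma coordSigma_le {V : Type*} (C : Set V) :
    coordSigma C ≤ (inferInstance : MeasurableSpace (V → ℝ)) :=
  (measurable_pi_lambda _ fun i : C => measurable_pi_apply (i : V)).comap_le

/-- The independences in a joint distribution `p` of real random variables indexed by `V`: the
triples `(A, B, C)` of (pairwise) disjoint subsets of `V` such that, under `p`, the coordinates in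
`A` are independent of those in `B` conditionally on those in `C`. -/
def distIndependences {V : Type*} [Finite V] (p : MeasureTheory.ProbabilityMeasure (V → ℝ)) :
    Set (Set V × Set V × Set V) :=
  {T | Disjoint T.1 T.2.1 ∧ Disjoint T.1 T.2.2 ∧ Disjoint T.2.1 T.2.2 ∧
    ProbabilityTheory.CondIndepFun (coordSigma T.2.2) (coordSigma_le T.2.2)
      (coordProj T.1) (coordProj T.2.1) (p : MeasureTheory.Measure (V → ℝ))}

namespace ChainGraph

/-- `p` is Markovian with respect to `G`: every independence represented by `G` holds in `p`. -/
def IsMarkovian {V : Type*} [Finite V] (G : ChainGraph V)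
    (p : MeasureTheory.ProbabilityMeasure (V → ℝ)) : Prop :=
  G.independences ⊆ distIndependences p

/-- `G` and `H` are Markov equivalent: the set of distributions that are Markovian with respect to
each of them is the same. -/
def MarkovEquivalent {V : Type*} [Finite V] (G H : ChainGraph V) : Prop :=
  {p : MeasureTheory.ProbabilityMeasure (V → ℝ) | G.IsMarkovian p} =
    {p : MeasureTheory.ProbabilityMeasure (V → ℝ) | H.IsMarkovian p}

end ChainGraph

/-! Equal independences trivially give equal sets of Markovian distributions. Conversely, if a
triple (A, B, C) is separated in G but H has a C-open route from a ∈ A to b ∈ B, it suffices to find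
a Gaussian distribution that is Markovian for H and violates the triple: by Markov equivalence it is
Markovian for G, a contradiction. This is `exists_isMarkovian_notMem_distIndependences`.

The Gaussian has concentration matrix K = (1 - D)ᵀ(1 - U)(1 - D), where D and U carry small
symmetric weights on the directed and undirected edges. Open routes are the paths of a finite state
graph `Flow` (`reachable_iff_exists_openRoute`). The same graph supports a linear system z = e + Nz
whose coordinate z(b, 2) is the covariance of X_b with the residual of X_a after regression on X_C
(`concMatrix_mulVec_of_solution`). Small weights make N contracting for every conditioning set, so z
vanishes at unreachable states. For Gaussians this gives conditional independence, hence the Markov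
property.

For the given C, the weights have signs and magnitudes such that a diagonal rescaling turns N into
N₀ + ζN₁ with N₀, N₁ ≥ 0 and ζ = -s². For small ζ > 0 positivity makes z nonzero at reachable
states. By Cramer's rule the numerator is a polynomial in ζ, so it is not identically zero and has
no root at small ζ < 0 either (`eventually_solution_ne_zero`). Hence the residual of X_a correlates
with X_b, and the triple fails. -/

open MeasureTheory ProbabilityTheory Filter Topology Matrix

/-! ### Open routes as reachability in a finite state graph. -/

namespace ChainGraph

variable {V : Type*}

/-- One step of the exploration of the open routes. The state `(y, k)` says that the node `y` has
been reached in such a way that the route may leave `y` backwards along a directed edge (`k = 0`),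
along an undirected edge (`k = 1`), or forwards along a directed edge (`k = 2`). -/
def Flow (G : ChainGraph V) (C : Set V) : V × Fin 3 → V × Fin 3 → Prop
  | (u, 0), (y, 0) => G.dir y u ∧ y ∉ C
  | (u, 0), (y, 1) => u = y ∧ y ∉ C
  | (u, 1), (y, 0) => (u = y ∨ G.undir u y) ∧ y ∈ C
  | (u, 1), (y, 1) => G.undir u y ∧ y ∉ C
  | (u, 1), (y, 2) => u = y ∧ y ∉ C
  | (u, 2), (y, 1) => G.dir u y ∧ u ∉ C ∧ y ∈ C
  | (u, 2), (y, 2) => G.dir u y ∧ u ∉ C ∧ y ∉ C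
  | _, _ => False

/-- The inner nodes of the route, and its first node, satisfy the condition for being `C`-open. -/
def InnerOpen (G : ChainGraph V) {a b : V} (ρ : G.Route a b) (C : Set V) : Prop :=
  ∀ i < ρ.length, (G.IsTriplexAt ρ i → ρ.getVert i ∈ C) ∧ (¬ G.IsTriplexAt ρ i → ρ.getVert i ∉ C)

/-- A route that has reached `y` from `p` in its `n`-th step may leave `y` in the way `k` codes. -/
def MayLeave (G : ChainGraph V) (C : Set V) (n : ℕ) (p y : V) : Fin 3 → Prop
  | 0 => (y ∉ C ∧ (n = 0 ∨ G.dir y p)) ∨ (y ∈ C ∧ 0 < n ∧ (G.dir p y ∨ G.undir p y))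
  | 1 => (y ∉ C ∧ (n = 0 ∨ G.dir y p ∨ G.undir p y)) ∨ (y ∈ C ∧ 0 < n ∧ G.dir p y)
  | 2 => y ∉ C

lemma getVert_concat_of_le {G : SimpleGraph V} {a y z : V} (ρ : G.Walk a y) (h : G.Adj y z)
    {i : ℕ} (hi : i ≤ ρ.length) : (ρ.concat h).getVert i = ρ.getVert i := by
  rw [SimpleGraph.Walk.concat_eq_append, SimpleGraph.Walk.getVert_append]
  split_ifs with h1
  · rfl
  · obtain rfl : i = ρ.length := by omega
    simp

/-- Only the old endpoint changes its role, from last node to inner node, so it alone needs a check.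
The guard `0 < ρ.length` reflects that the first node of a route is never a triplex node. -/
lemma InnerOpen.concat {G : ChainGraph V} {C : Set V} {a y z : V} {ρ : G.Route a y}
    (hρ : G.InnerOpen ρ C) (h : G.skeleton.Adj y z)
    (h1 : 0 < ρ.length → G.TriplexPattern (ρ.getVert (ρ.length - 1)) y z → y ∈ C)
    (h2 : (0 < ρ.length → ¬ G.TriplexPattern (ρ.getVert (ρ.length - 1)) y z) → y ∉ C) :
    G.InnerOpen (ρ.concat h) C := by
  intro i hi
  rw [SimpleGraph.Walk.length_concat] at hi
  unfold IsTriplexAt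
  rw [SimpleGraph.Walk.length_concat, getVert_concat_of_le ρ h (by omega : i ≤ ρ.length),
    getVert_concat_of_le ρ h (by omega : i - 1 ≤ ρ.length)]
  rcases (Nat.lt_succ_iff_lt_or_eq.mp hi) with hi' | rfl
  · rw [getVert_concat_of_le ρ h (by omega : i + 1 ≤ ρ.length)]
    have := hρ i hi'
    unfold IsTriplexAt at this
    simp only [hi', hi, true_and] at this ⊢
    exact this
  · have hz : (ρ.concat h).getVert (ρ.length + 1) = z := by
      rw [← SimpleGraph.Walk.length_concat ρ h, SimpleGraph.Walk.getVert_length]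
    rw [hz, SimpleGraph.Walk.getVert_length]
    refine ⟨fun ⟨h3, _, h4⟩ => h1 h3 h4, fun h3 => h2 fun h4 h5 => h3 ⟨h4, by omega, h5⟩⟩

/-- A step of the exploration either stays at the node or prolongs the route by one edge. -/
lemma exists_route_of_flow {G : ChainGraph V} {C : Set V} {a y z : V} {k l : Fin 3}
    (h : G.Flow C (y, k) (z, l)) (ρ : G.Route a y) (hρ : G.InnerOpen ρ C)
    (hk : G.MayLeave C ρ.length (ρ.getVert (ρ.length - 1)) y k) :
    ∃ σ : G.Route a z, G.InnerOpen σ C ∧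
      G.MayLeave C σ.length (σ.getVert (σ.length - 1)) z l := by
  -- Common treatment of the steps that use an edge; the steps with y = z keep the route and only
  -- weaken the permission to leave.
  have key : ∀ hyz : G.skeleton.Adj y z,
      (0 < ρ.length → G.TriplexPattern (ρ.getVert (ρ.length - 1)) y z → y ∈ C) →
      ((0 < ρ.length → ¬ G.TriplexPattern (ρ.getVert (ρ.length - 1)) y z) → y ∉ C) →
      G.MayLeave C (ρ.length + 1) y z l →
      ∃ σ : G.Route a z, G.InnerOpen σ C ∧
        G.MayLeave C σ.length (σ.getVert (σ.length - 1)) z l := by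
    intro hyz h1 h2 h3
    refine ⟨ρ.concat hyz, hρ.concat hyz h1 h2, ?_⟩
    rw [SimpleGraph.Walk.length_concat, Nat.add_sub_cancel, getVert_concat_of_le ρ hyz le_rfl,
      SimpleGraph.Walk.getVert_length]
    exact h3
  set p := ρ.getVert (ρ.length - 1)
  set n := ρ.length
  have e1 := G.dir_asymm
  have e2 := G.not_dir_and_undir
  have e3 := G.undir_symm
  have a1 : G.dir y z → G.skeleton.Adj y z := fun h => Or.inl h
  have a2 : G.dir z y → G.skeleton.Adj y z := fun h => Or.inr (Or.inl h)
  have a3 : G.undir y z → G.skeleton.Adj y z := fun h => Or.inr (Or.inr h)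
  unfold TriplexPattern at key
  fin_cases k <;> fin_cases l <;> simp only [Flow, MayLeave] at h hk key ⊢ <;>
    first
    | exact h.elim
    | (obtain ⟨rfl, h⟩ := h
       refine ⟨ρ, hρ, ?_⟩
       tauto)
    | (obtain ⟨h, h'⟩ := h
       refine key (a2 h) ?_ ?_ ?_ <;> grind)
    | (obtain ⟨h, h'⟩ := h
       refine key (a1 h) ?_ ?_ ?_ <;> grind)
    | (obtain ⟨h, h'⟩ := h
       refine key (a3 h) ?_ ?_ ?_ <;> grind)
    | (obtain ⟨rfl | h, h'⟩ := h
       · refine ⟨ρ, hρ, ?_⟩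
         tauto
       · refine key (a3 h) ?_ ?_ ?_ <;> grind)

lemma exists_route_of_reachable {G : ChainGraph V} {C : Set V} {a : V} (ha : a ∉ C)
    {s : V × Fin 3} (h : Relation.ReflTransGen (G.Flow C) (a, 0) s) :
    ∃ σ : G.Route a s.1, G.InnerOpen σ C ∧
      G.MayLeave C σ.length (σ.getVert (σ.length - 1)) s.1 s.2 := by
  induction h with
  | refl => exact ⟨.nil, fun i hi => absurd hi (by simp), by simp [MayLeave, ha]⟩
  | tail _ h2 ih =>
    obtain ⟨ρ, hρ, hk⟩ := ih
    exact exists_route_of_flow h2 ρ hρ hk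

/-- The induction carries all permitted states k at once, because only the next edge decides from
which state the current node must be left. At i = 0 the truncated index i - 1 is harmless:
`MayLeave` looks at the preceding node only when the step count is positive or as an alternative to
its being zero. -/
lemma reachable_of_route {G : ChainGraph V} {C : Set V} {a b : V} (ha : a ∉ C)
    (ρ : G.Route a b) (hρ : G.IsOpenRoute ρ C) {i : ℕ} (hi : i ≤ ρ.length) (k : Fin 3)
    (hk : G.MayLeave C i (ρ.getVert (i - 1)) (ρ.getVert i) k) :
    Relation.ReflTransGen (G.Flow C) (a, 0) (ρ.getVert i, k) := by
  induction i generalizing k with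
  | zero =>
    simp only [SimpleGraph.Walk.getVert_zero] at hk ⊢
    have h1 : Relation.ReflTransGen (G.Flow C) (a, 0) (a, 1) := .single ⟨rfl, ha⟩
    fin_cases k
    · exact .refl
    · exact h1
    · exact h1.tail ⟨rfl, ha⟩
  | succ i ih =>
    have ih := ih (by omega)
    have hadj : G.skeleton.Adj (ρ.getVert i) (ρ.getVert (i + 1)) :=
      ρ.adj_getVert_succ (by omega)
    have hst := hρ i (by omega)
    have hprev : 0 < i → G.skeleton.Adj (ρ.getVert (i - 1)) (ρ.getVert i) := fun h0 => by
      have := ρ.adj_getVert_succ (show i - 1 < ρ.length by omega)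
      rwa [Nat.sub_add_cancel h0] at this
    unfold IsTriplexAt TriplexPattern at hst
    simp only [Nat.add_sub_cancel] at hk
    have hlt : i < ρ.length := by omega
    simp only [hlt, true_and] at hst
    generalize ρ.getVert (i - 1) = p at *
    generalize ρ.getVert i = y at *
    generalize ρ.getVert (i + 1) = u at *
    have e1 := G.dir_asymm
    have e2 := G.not_dir_and_undir
    have e3 := G.undir_symm
    have hprev' : 0 < i → G.dir p y ∨ G.dir y p ∨ G.undir p y := hprev
    have hadj : G.dir y u ∨ G.dir u y ∨ G.undir y u := hadj
    clear hprev
    have i0 := ih 0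
    have i1 := ih 1
    have i2 := ih 2
    simp only [MayLeave] at i0 i1 i2
    -- From here on each fact treats one target state at u: openness at y says from which state y is
    -- left along the given edge.
    have x0 : G.dir u y → u ∉ C → Relation.ReflTransGen (G.Flow C) (a, 0) (u, 0) := by
      intro h1 h2
      refine (i0 ?_).tail ⟨h1, h2⟩
      grind
    have x1 : G.undir y u → Relation.ReflTransGen (G.Flow C) (a, 0) (y, 1) := by
      intro h1
      refine i1 ?_
      grind
    have x2 : G.dir y u → y ∉ C := by grind
    have y1 : u ∈ C → G.dir y u → Relation.ReflTransGen (G.Flow C) (a, 0) (u, 1) :=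
      fun h1 h2 => (i2 (x2 h2)).tail ⟨h2, x2 h2, h1⟩
    have y0 : u ∈ C → (G.dir y u ∨ G.undir y u) →
        Relation.ReflTransGen (G.Flow C) (a, 0) (u, 0) := by
      rintro h1 (h2 | h2)
      · exact (y1 h1 h2).tail ⟨Or.inl rfl, h1⟩
      · exact (x1 h2).tail ⟨Or.inr h2, h1⟩
    have z1 : u ∉ C → (G.dir u y ∨ G.undir y u) →
        Relation.ReflTransGen (G.Flow C) (a, 0) (u, 1) := by
      rintro h1 (h2 | h2)
      · exact (x0 h2 h1).tail ⟨rfl, h1⟩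
      · exact (x1 h2).tail ⟨h2, h1⟩
    have z2 : u ∉ C → (G.dir y u ∨ G.dir u y ∨ G.undir y u) →
        Relation.ReflTransGen (G.Flow C) (a, 0) (u, 2) := by
      rintro h1 (h2 | h2)
      · exact (i2 (x2 h2)).tail ⟨h2, x2 h2, h1⟩
      · exact (z1 h1 h2).tail ⟨rfl, h1⟩
    fin_cases k <;> simp only [MayLeave] at hk
    · rcases hk with ⟨h1, h2 | h2⟩ | ⟨h1, -, h2⟩
      · omega
      · exact x0 h2 h1
      · exact y0 h1 h2
    · rcases hk with ⟨h1, h2 | h2⟩ | ⟨h1, -, h2⟩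
      · omega
      · exact z1 h1 h2
      · exact y1 h1 h2
    · exact z2 hk hadj

/-- The exploration finds exactly the nodes that an open route connects with `a`. -/
lemma reachable_iff_exists_openRoute {G : ChainGraph V} {C : Set V} {a b : V} (ha : a ∉ C)
    (hb : b ∉ C) :
    Relation.ReflTransGen (G.Flow C) (a, 0) (b, 2) ↔ ∃ ρ : G.Route a b, G.IsOpenRoute ρ C := by
  constructor
  · intro h
    obtain ⟨ρ, hρ, -⟩ := exists_route_of_reachable ha h
    refine ⟨ρ, fun i hi => ?_⟩
    rcases hi.lt_or_eq with hi | rfl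
    · exact hρ i hi
    · rw [SimpleGraph.Walk.getVert_length]
      exact ⟨fun h => absurd h.2.1 (lt_irrefl _), fun _ => hb⟩
  · rintro ⟨ρ, hρ⟩
    have := reachable_of_route ha ρ hρ le_rfl 2 (by simpa [MayLeave] using hb)
    rwa [SimpleGraph.Walk.getVert_length] at this

end ChainGraph

/-! ### Contracting linear systems and the support of their solutions. -/

section Contracting

variable {ι : Type*} [Fintype ι]

/-- A square matrix is contracting if it decreases, in absolute value, some positive vector. -/
def Matrix.IsContracting (N : Matrix ι ι ℝ) : Prop :=
  ∃ v : ι → ℝ, (∀ i, 0 < v i) ∧ ∀ i, ∑ j, |N i j| * v j < v i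

namespace Matrix.IsContracting

variable {N : Matrix ι ι ℝ}

/-- Maximum principle: at an index maximizing u / v, a positive value would contradict the strict
decrease of v. -/
lemma eq_zero_of_le (hN : N.IsContracting) {u : ι → ℝ} (hu : ∀ i, 0 ≤ u i)
    (h : ∀ i, u i ≤ ∑ j, |N i j| * u j) (i : ι) : u i = 0 := by
  obtain ⟨v, hv, hNv⟩ := hN
  have : Nonempty ι := ⟨i⟩
  obtain ⟨m, hm⟩ := Finite.exists_max fun j => u j / v j
  have hle : ∀ j, u j ≤ u m / v m * v j := fun j => (div_le_iff₀ (hv j)).1 (hm j)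
  have hum : u m = 0 := by
    by_contra hne
    have hpos : 0 < u m / v m := div_pos ((hu m).lt_of_ne' hne) (hv m)
    have h1 : u m ≤ u m / v m * ∑ j, |N m j| * v j := by
      refine (h m).trans ?_
      rw [Finset.mul_sum]
      refine Finset.sum_le_sum fun j _ => ?_
      calc |N m j| * u j ≤ |N m j| * (u m / v m * v j) := by gcongr; exact hle j
        _ = _ := by ring
    have h2 := mul_lt_mul_of_pos_left (hNv m) hpos
    rw [div_mul_cancel₀ _ (hv m).ne'] at h2
    linarith
  have := hle i
  rw [hum] at this
  simp only [zero_div, zero_mul] at this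
  exact le_antisymm this (hu i)

/-- A solution of `z = e + N z` vanishes at the indices that cannot be reached from the support of
`e` along nonzero entries of `N`. -/
lemma eq_zero_of_not_mem (hN : N.IsContracting) {e z : ι → ℝ} (hz : z = e + N *ᵥ z)
    (P : Set ι) (he : ∀ i ∉ P, e i = 0) (hP : ∀ i j, N i j ≠ 0 → j ∈ P → i ∈ P) {i : ι}
    (hi : i ∉ P) : z i = 0 := by
  classical
  -- The function |z| cut off on P is a subsolution, since no entry of N leads from P to its
  -- complement.
  have := hN.eq_zero_of_le (u := fun i => if i ∈ P then 0 else |z i|)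
    (fun i => by split_ifs <;> positivity) (fun i => ?_) i
  · simpa [hi] using this
  · by_cases h : i ∈ P
    · simp only [h, if_true]
      exact Finset.sum_nonneg fun j _ => by split_ifs <;> positivity
    · simp only [h, if_false]
      have h1 : z i = ∑ j, N i j * z j := by
        conv_lhs => rw [hz]
        simp [he i h, Matrix.mulVec, dotProduct]
      rw [h1]
      refine (Finset.abs_sum_le_sum_abs _ _).trans (Finset.sum_le_sum fun j _ => ?_)
      rw [abs_mul]
      split_ifs with hj
      · have : N i j = 0 := by
          by_contra hne
          exact h (hP i j hne hj)
        simp [this]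
      · exact le_rfl

lemma det_ne_zero [DecidableEq ι] (hN : N.IsContracting) : (1 - N).det ≠ 0 := by
  intro h
  obtain ⟨z, hz0, hz⟩ := Matrix.exists_mulVec_eq_zero_iff.2 h
  refine hz0 (funext fun i => ?_)
  rw [Matrix.sub_mulVec, Matrix.one_mulVec, sub_eq_zero] at hz
  exact hN.eq_zero_of_not_mem (e := 0) (by rw [zero_add]; exact hz) ∅ (by simp) (by simp)
    (Set.notMem_empty i)

lemma exists_solution (hN : N.IsContracting) (e : ι → ℝ) : ∃ z, z = e + N *ᵥ z := by
  classical
  have hu : IsUnit (1 - N).det := isUnit_iff_ne_zero.2 hN.det_ne_zero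
  refine ⟨(1 - N)⁻¹ *ᵥ e, ?_⟩
  have : (1 - N) *ᵥ ((1 - N)⁻¹ *ᵥ e) = e := by
    rw [Matrix.mulVec_mulVec, Matrix.mul_nonsing_inv _ hu, Matrix.one_mulVec]
  rw [Matrix.sub_mulVec, Matrix.one_mulVec] at this
  exact sub_eq_iff_eq_add.1 this

/-- The negative part of z is a subsolution, so the maximum principle kills it. -/
lemma nonneg_of_eq (hN : N.IsContracting) (hN0 : ∀ i j, 0 ≤ N i j) {e z : ι → ℝ}
    (he : ∀ i, 0 ≤ e i) (hz : z = e + N *ᵥ z) (i : ι) : 0 ≤ z i := by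
  have := hN.eq_zero_of_le (u := fun i => max (-z i) 0) (fun i => le_max_right _ _) (fun i => ?_) i
  · simpa using this
  · refine max_le ?_ (Finset.sum_nonneg fun j _ => by positivity)
    have h1 : z i = e i + ∑ j, N i j * z j := by
      conv_lhs => rw [hz]
      rfl
    rw [h1, neg_add, ← Finset.sum_neg_distrib]
    have : ∑ j, -(N i j * z j) ≤ ∑ j, |N i j| * max (-z j) 0 := by
      refine Finset.sum_le_sum fun j _ => ?_
      rw [abs_of_nonneg (hN0 i j), ← mul_neg]
      exact mul_le_mul_of_nonneg_left (le_max_left _ _) (hN0 i j)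
    linarith [he i]

lemma pos_of_reachable (hN : N.IsContracting) (hN0 : ∀ i j, 0 ≤ N i j) {e z : ι → ℝ}
    (he : ∀ i, 0 ≤ e i) (hz : z = e + N *ᵥ z) {i j : ι} (hi : 0 < e i)
    (h : Relation.ReflTransGen (fun k l => 0 < N l k) i j) : 0 < z j := by
  have hz0 := hN.nonneg_of_eq hN0 he hz
  have h1 : ∀ i, z i = e i + ∑ j, N i j * z j := fun i => by
    conv_lhs => rw [hz]
    rfl
  induction h with
  | refl =>
    rw [h1]
    exact add_pos_of_pos_of_nonneg hi
      (Finset.sum_nonneg fun j _ => mul_nonneg (hN0 _ _) (hz0 _))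
  | @tail k l _ hkl ih =>
    rw [h1]
    refine add_pos_of_nonneg_of_pos (he l) ?_
    refine lt_of_lt_of_le (mul_pos hkl ih) ?_
    exact Finset.single_le_sum (f := fun j => N l j * z j)
      (fun j _ => mul_nonneg (hN0 _ _) (hz0 _)) (Finset.mem_univ k)

/-- A matrix that strictly increases a rank function is contracting. -/
lemma of_rank (r : ι → ℕ) (h : ∀ i j, N i j ≠ 0 → r j < r i) : N.IsContracting := by
  -- D exceeds every absolute row sum and is at least 1, so the vector with entries D ^ rank is
  -- strictly decreased.
  set D : ℝ := 1 + ∑ i, ∑ j, |N i j| with hD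
  have hD1 : 1 ≤ D := le_add_of_nonneg_right (by positivity)
  refine ⟨fun i => D ^ r i, fun i => by positivity, fun i => ?_⟩
  have hrow : ∑ j, |N i j| < D := by
    have : ∑ j, |N i j| ≤ ∑ i, ∑ j, |N i j| :=
      Finset.single_le_sum (f := fun i => ∑ j, |N i j|) (fun i _ => by positivity)
        (Finset.mem_univ i)
    linarith
  rcases Nat.eq_zero_or_pos (r i) with h0 | h0
  · have : ∀ j, N i j = 0 := fun j => by
      by_contra hne
      have := h i j hne
      omega
    simp [this, h0]
  · calc ∑ j, |N i j| * D ^ r j ≤ ∑ j, |N i j| * D ^ (r i - 1) := by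
          refine Finset.sum_le_sum fun j _ => ?_
          by_cases hne : N i j = 0
          · simp [hne]
          · have := h i j hne
            gcongr
            omega
      _ = (∑ j, |N i j|) * D ^ (r i - 1) := by rw [Finset.sum_mul]
      _ < D * D ^ (r i - 1) := by gcongr
      _ = D ^ r i := by rw [← pow_succ', Nat.sub_add_cancel h0]

/-- The same positive vector works for nearby matrices, because it satisfies finitely many strict
inequalities. -/
lemma eventually {α : Type*} {l : Filter α} (hN : N.IsContracting) {F : α → Matrix ι ι ℝ}
    (hF : ∀ i j, Tendsto (fun a => F a i j) l (𝓝 (N i j))) : ∀ᶠ a in l, (F a).IsContracting := by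
  obtain ⟨v, hv, hNv⟩ := hN
  have : ∀ᶠ a in l, ∀ i, ∑ j, |F a i j| * v j < v i := by
    refine eventually_all.2 fun i => ?_
    have : Tendsto (fun a => ∑ j, |F a i j| * v j) l (𝓝 (∑ j, |N i j| * v j)) :=
      tendsto_finsetSum _ fun j _ => (hF i j).abs.mul_const _
    exact this.eventually_lt_const (hNv i)
  exact this.mono fun a ha => ⟨v, hv, ha⟩

end Matrix.IsContracting

/-- If `N₀` strictly increases a rank function and `N₀`, `N₁` are nonnegative, then, for all small
`ζ ≠ 0`, the solutions of `z = eᵢ + (N₀ + ζ N₁) z` are nonzero at the indices that can be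
reached from `i`. -/
lemma eventually_solution_ne_zero [DecidableEq ι] {N₀ N₁ : Matrix ι ι ℝ} (r : ι → ℕ)
    (hr : ∀ i j, N₀ i j ≠ 0 → r j < r i) (h₀ : ∀ i j, 0 ≤ N₀ i j) (h₁ : ∀ i j, 0 ≤ N₁ i j)
    {i j : ι} (hij : Relation.ReflTransGen (fun k l => 0 < N₀ l k + N₁ l k) i j) :
    ∀ᶠ ζ in 𝓝[≠] (0 : ℝ), ∀ z : ι → ℝ,
      z = Pi.single i 1 + (N₀ + ζ • N₁) *ᵥ z → z j ≠ 0 := by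
  -- By Cramer's rule this adjugate entry is the numerator of z j as a function of ζ.
  set p : Polynomial ℝ :=
    (adjugate (1 - (N₀.map Polynomial.C + (Polynomial.X : Polynomial ℝ) • N₁.map Polynomial.C))) j i
    with hp
  have heval : ∀ ζ, p.eval ζ = adjugate (1 - (N₀ + ζ • N₁)) j i := by
    intro ζ
    have h1 := RingHom.map_adjugate (Polynomial.evalRingHom ζ)
      (1 - (N₀.map Polynomial.C + (Polynomial.X : Polynomial ℝ) • N₁.map Polynomial.C))
    have h2 : (Polynomial.evalRingHom ζ).mapMatrix
        (1 - (N₀.map Polynomial.C + (Polynomial.X : Polynomial ℝ) • N₁.map Polynomial.C)) =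
        1 - (N₀ + ζ • N₁) := by
      rw [map_sub, map_one, map_add]
      congr 2
      · ext k l; simp
      · ext k l; simp [mul_comm ζ]
    rw [h2] at h1
    rw [← h1, hp]
    rfl
  have hcramer : ∀ ζ (z : ι → ℝ), z = Pi.single i 1 + (N₀ + ζ • N₁) *ᵥ z →
      (1 - (N₀ + ζ • N₁)).det * z j = p.eval ζ := by
    intro ζ z hz
    have h1 : (1 - (N₀ + ζ • N₁)) *ᵥ z = Pi.single i 1 := by
      rw [Matrix.sub_mulVec, Matrix.one_mulVec]
      exact sub_eq_iff_eq_add.2 hz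
    have h2 := congrArg (fun y => (adjugate (1 - (N₀ + ζ • N₁)) *ᵥ y) j) h1
    simp only [Matrix.mulVec_mulVec, Matrix.adjugate_mul, Matrix.smul_mulVec, Matrix.one_mulVec]
      at h2
    rw [heval]
    simpa using h2
  have hcontr : ∀ᶠ ζ in 𝓝 (0 : ℝ), (N₀ + ζ • N₁).IsContracting := by
    refine (Matrix.IsContracting.of_rank r hr).eventually fun k l => ?_
    have : Continuous fun ζ : ℝ => (N₀ + ζ • N₁) k l := by
      simp only [Matrix.add_apply, Matrix.smul_apply]
      fun_prop
    simpa using this.tendsto 0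
  -- One small positive ζ suffices, where nonnegativity makes z j positive; the conclusion then also
  -- covers negative ζ.
  have hp0 : p ≠ 0 := by
    obtain ⟨ζ, hζ, hζ0⟩ := ((hcontr.filter_mono nhdsWithin_le_nhds).and
      (self_mem_nhdsWithin : Set.Ioi (0 : ℝ) ∈ 𝓝[>] 0)).exists
    obtain ⟨z, hz⟩ := hζ.exists_solution (Pi.single i 1)
    have hζ0 : 0 < ζ := hζ0
    have hzj : 0 < z j := by
      refine hζ.pos_of_reachable (fun k l => ?_) (fun k => ?_) hz (i := i) (by simp) ?_
      · exact add_nonneg (h₀ k l) (mul_nonneg hζ0.le (h₁ k l))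
      · by_cases h : k = i
        · subst h; simp
        · simp [h]
      · refine Relation.ReflTransGen.mono (fun k l hkl => ?_) i j hij
        simp only [Matrix.add_apply, Matrix.smul_apply, smul_eq_mul]
        rcases (h₀ l k).eq_or_lt with h | h
        · rw [← h, zero_add] at hkl ⊢
          positivity
        · have := mul_nonneg hζ0.le (h₁ l k)
          linarith
    intro h
    have := hcramer ζ z hz
    rw [h, Polynomial.eval_zero] at this
    exact (mul_ne_zero hζ.det_ne_zero hzj.ne') this
  have hroots : ∀ᶠ ζ in 𝓝[≠] (0 : ℝ), ζ ∉ (p.roots.toFinset : Set ℝ) :=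
    nhdsNE_le_cofinite 0 p.roots.toFinset.finite_toSet.compl_mem_cofinite
  refine hroots.mono fun ζ hζ z hz h => hζ ?_
  have := hcramer ζ z hz
  rw [h, mul_zero] at this
  simp [hp0, ← this, Polynomial.IsRoot]

end Contracting

/-! ### Conditional independence and residuals. -/

section CondIndep

variable {Ω E E' F F' : Type*} {m m₂ : MeasurableSpace Ω} {mΩ : MeasurableSpace Ω}
  [MeasurableSpace E] [MeasurableSpace E'] [MeasurableSpace F] [MeasurableSpace F']
  {μ : Measure Ω} [IsProbabilityMeasure μ]

/-- If `s` is independent of the σ-algebras `m` and `m₂` jointly, it factors out of the conditional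
probability given `m`. -/
lemma condExp_indicator_of_indep (hm : m ≤ mΩ) (hm₂ : m₂ ≤ mΩ) {s t u : Set Ω}
    (hs : MeasurableSet s) (ht : MeasurableSet[m₂] t)
    (hu : MeasurableSet[m] u)
    (h : ∀ v, MeasurableSet[m ⊔ m₂] v → μ (s ∩ v) = μ s * μ v) :
    μ⟦s ∩ u ∩ t | m⟧ =ᵐ[μ] fun ω => μ.real s * u.indicator (μ⟦t | m⟧) ω := by
  have hu' := hm _ hu
  have ht' := hm₂ _ ht
  symm
  refine ae_eq_condExp_of_forall_setIntegral_eq hm ?_ ?_ ?_ ?_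
  · exact (integrable_const (1 : ℝ)).indicator ((hs.inter hu').inter ht')
  · exact fun v _ _ => ((integrable_condExp.indicator hu').const_mul _).integrableOn
  · intro v hv _
    have hv' := hm _ hv
    rw [integral_const_mul, setIntegral_indicator hu',
      setIntegral_condExp hm ((integrable_const (1 : ℝ)).indicator ht') (hv.inter hu),
      setIntegral_indicator ht', setIntegral_indicator ((hs.inter hu').inter ht')]
    simp only [integral_const, smul_eq_mul, mul_one, measureReal_restrict_apply_univ]
    have : v ∩ (s ∩ u ∩ t) = s ∩ (v ∩ u ∩ t) := by
      ext x; simp only [Set.mem_inter_iff]; tauto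
    rw [this, measureReal_def, measureReal_def, measureReal_def, h, ENNReal.toReal_mul]
    refine MeasurableSet.inter (MeasurableSet.inter ?_ ?_) ?_
    · exact (le_sup_left : m ≤ m ⊔ m₂) _ hv
    · exact (le_sup_left : m ≤ m ⊔ m₂) _ hu
    · exact (le_sup_right : m₂ ≤ m ⊔ m₂) _ ht
  · exact ((stronglyMeasurable_condExp.indicator hu).const_mul _).aestronglyMeasurable

variable [StandardBorelSpace Ω]

/-- If `R` is independent of `(Y, Z)`, then every function of `R` and `Z` is independent of `Y`
conditionally on `Z`. -/
lemma condIndepFun_of_indepFun_prodMk {R : Ω → E} {Y : Ω → F} {Z : Ω → F'} (hR : Measurable R)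
    (hY : Measurable Y) (hZ : Measurable Z) (h : IndepFun R (fun ω => (Y ω, Z ω)) μ)
    {φ : E × F' → E'} (hφ : Measurable φ) :
    CondIndepFun (MeasurableSpace.comap Z inferInstance) hZ.comap_le
      (fun ω => φ (R ω, Z ω)) Y μ := by
  have hRZ : CondIndepFun (MeasurableSpace.comap Z inferInstance) hZ.comap_le
      (fun ω => (R ω, Z ω)) Y μ := by
    rw [condIndepFun_iff_condIndep]
    have hind : ∀ s : Set E, MeasurableSet s → ∀ v, MeasurableSet[MeasurableSpace.comap Z
        inferInstance ⊔ MeasurableSpace.comap Y inferInstance] v →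
        μ (R ⁻¹' s ∩ v) = μ (R ⁻¹' s) * μ v := by
      intro s hs v hv
      refine (Indep_iff _ _ _).1 h _ _ ⟨s, hs, rfl⟩ ?_
      refine (sup_le ?_ ?_ : _ ≤ MeasurableSpace.comap (fun ω => (Y ω, Z ω)) inferInstance) v hv
      · exact (measurable_snd.comp (comap_measurable fun ω => (Y ω, Z ω))).comap_le
      · exact (measurable_fst.comp (comap_measurable fun ω => (Y ω, Z ω))).comap_le
    -- It suffices to test (R, Z) on rectangles, where the factor from R splits off.
    refine CondIndepSets.condIndep
      (p1 := {t | ∃ q ∈ Set.image2 (· ×ˢ ·) {s : Set E | MeasurableSet s}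
        {u : Set F' | MeasurableSet u}, (fun ω => (R ω, Z ω)) ⁻¹' q = t})
      (p2 := {t | MeasurableSet[MeasurableSpace.comap Y inferInstance] t})
      (hR.prodMk hZ).comap_le hY.comap_le (isPiSystem_prod.comap _)
      (@MeasurableSpace.isPiSystem_measurableSet _ (MeasurableSpace.comap Y inferInstance))
      ?_ (@MeasurableSpace.generateFrom_measurableSet _ (MeasurableSpace.comap Y _)).symm ?_
    · rw [← generateFrom_prod, MeasurableSpace.comap_generateFrom]
      rfl
    · rw [condIndepSets_iff]
      · rintro _ t ⟨_, ⟨s, hs, u, hu, rfl⟩, rfl⟩ ht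
        have hs : MeasurableSet s := hs
        have hu : MeasurableSet[MeasurableSpace.comap Z inferInstance] (Z ⁻¹' u) := ⟨u, hu, rfl⟩
        have e1 : (fun ω => (R ω, Z ω)) ⁻¹' (s ×ˢ u) = R ⁻¹' s ∩ Z ⁻¹' u := rfl
        have c1 := condExp_indicator_of_indep (μ := μ) (t := t) hZ.comap_le hY.comap_le (hR hs) ht hu
          (hind s hs)
        -- Taking the whole space for t gives the conditional probability of the rectangle alone.
        have c2 := condExp_indicator_of_indep (μ := μ) hZ.comap_le hY.comap_le (hR hs)
          MeasurableSet.univ hu (hind s hs)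
        rw [Set.inter_univ] at c2
        have c3 : μ⟦(Set.univ : Set Ω) | MeasurableSpace.comap Z inferInstance⟧ = fun _ => 1 := by
          simp only [Set.indicator_univ]
          exact condExp_const hZ.comap_le 1
        rw [c3] at c2
        simp only [e1]
        filter_upwards [c1, c2] with ω h1 h2
        rw [h1, Pi.mul_apply, h2]
        by_cases hω : ω ∈ Z ⁻¹' u <;> simp [hω]
      · rintro _ ⟨_, ⟨s, hs, u, hu, rfl⟩, rfl⟩
        exact (hR.prodMk hZ) (MeasurableSet.prod hs hu)
      · exact fun t ht => hY.comap_le _ ht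
  exact hRZ.comp hφ measurable_id

/-- If `X` and `Y` are conditionally independent and `X + L` is a centred variable independent of
the conditioning σ-algebra, for some `L` measurable with respect to it, then `X + L` and `Y` are
uncorrelated. -/
lemma ProbabilityTheory.CondIndepFun.integral_residual_mul_eq_zero {hm : m ≤ mΩ} {X Y L : Ω → ℝ}
    (h : CondIndepFun m hm X Y μ) (hX : Measurable X) (hY : Measurable Y)
    (hL : Measurable[m] L) (hX2 : MemLp X 2 μ) (hY2 : MemLp Y 2 μ) (hL2 : MemLp L 2 μ)
    (hind : Indep (MeasurableSpace.comap (X + L) inferInstance) m μ) (h0 : μ[X + L] = 0) :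
    ∫ ω, (X + L) ω * Y ω ∂μ = 0 := by
  have hL' : Measurable L := hL.mono hm le_rfl
  have hXY : Integrable (X * Y) μ := hX2.integrable_mul hY2
  have hLY : Integrable (L * Y) μ := hL2.integrable_mul hY2
  have iX := hX2.integrable one_le_two
  have iY := hY2.integrable one_le_two
  have iL := hL2.integrable one_le_two
  -- For almost every ω, X and Y are independent under the conditional kernel, so the mean of the
  -- product factors there.
  have k1 : μ[X * Y | m] =ᵐ[μ] μ[X | m] * μ[Y | m] := by
    have hk := ae_of_ae_trim hm ((condIndepFun_iff_map_prod_eq_prod_map_map hX hY).1 h)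
    filter_upwards [hk, condExp_ae_eq_integral_condExpKernel hm hXY,
      condExp_ae_eq_integral_condExpKernel hm iX, condExp_ae_eq_integral_condExpKernel hm iY]
      with ω h1 h2 h3 h4
    rw [h2, Pi.mul_apply, h3, h4]
    refine IndepFun.integral_mul_eq_mul_integral ?_ hX.aestronglyMeasurable hY.aestronglyMeasurable
    rw [indepFun_iff_map_prod_eq_prod_map_map hX.aemeasurable hY.aemeasurable]
    rwa [Kernel.map_apply _ (hX.prodMk hY), Kernel.prod_apply, Kernel.map_apply _ hX,
      Kernel.map_apply _ hY] at h1
  have k2 : μ[L * Y | m] =ᵐ[μ] L * μ[Y | m] :=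
    condExp_mul_of_stronglyMeasurable_left hL.stronglyMeasurable hLY iY
  have k3 : μ[X + L | m] =ᵐ[μ] fun _ => μ[X + L] :=
    condExp_indep_eq (hX.add hL').comap_le hm
      (comap_measurable (X + L)).stronglyMeasurable hind
  have k4 : μ[X + L | m] =ᵐ[μ] μ[X | m] + L := by
    refine (condExp_add iX iL m).trans ?_
    rw [condExp_of_stronglyMeasurable hm hL.stronglyMeasurable iL]
  -- E[(X + L)Y | m] = E[X + L | m] E[Y | m], and the first factor is the constant mean 0.
  have k5 : μ[X * Y + L * Y | m] =ᵐ[μ] 0 := by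
    refine (condExp_add hXY hLY m).trans ?_
    filter_upwards [k1, k2, k3, k4] with ω h1 h2 h3 h4
    rw [h0] at h3
    rw [h3] at h4
    simp only [Pi.add_apply, Pi.mul_apply, Pi.zero_apply] at h1 h2 h4 ⊢
    rw [h1, h2, ← add_mul, ← h4, zero_mul]
  calc ∫ ω, (X + L) ω * Y ω ∂μ = ∫ ω, (X * Y + L * Y) ω ∂μ := by
        congr with ω
        simp [add_mul]
    _ = ∫ ω, (μ[X * Y + L * Y | m]) ω ∂μ := (integral_condExp hm).symm
    _ = 0 := by rw [integral_congr_ae k5]; simp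

end CondIndep

/-! ### The linear model and its flow equations. -/

namespace ChainGraph

variable {V : Type*}

open Classical in
/-- The matrix of the coefficients `w y u` of the edges `u → y`. -/
noncomputable def dirMatrix (G : ChainGraph V) (w : V → V → ℝ) : Matrix V V ℝ :=
  fun y u => if G.dir u y then w y u else 0

open Classical in
/-- The matrix of the coefficients `w y u` of the edges `u - y`. -/
noncomputable def undirMatrix (G : ChainGraph V) (w : V → V → ℝ) : Matrix V V ℝ :=
  fun y u => if G.undir u y then w y u else 0

open Classical in
/-- The coefficients of the steps of `G.Flow C` in the linear equations for the partial covariances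
given `C`. -/
noncomputable def flowMatrix (G : ChainGraph V) (C : Set V) (w : V → V → ℝ) :
    Matrix (V × Fin 3) (V × Fin 3) ℝ :=
  fun i j => if G.Flow C j i then
    if i.1 = j.1 then 1 else (if i.1 ∈ C then -1 else 1) * w i.1 j.1 else 0

/-- The concentration matrix of the linear model with the coefficients `w`. -/
noncomputable def concMatrix [Fintype V] [DecidableEq V] (G : ChainGraph V) (w : V → V → ℝ) :
    Matrix V V ℝ :=
  (1 - G.dirMatrix w)ᵀ * (1 - G.undirMatrix w) * (1 - G.dirMatrix w)

/-- Vanishing of z(c, 2) on C lets the last sum run over all u although the flow leaves state 2 only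
outside C. Symmetry of w is what turns the backward steps into the transpose of D. -/
lemma flowMatrix_mulVec_of_notMem [Fintype V] {G : ChainGraph V} {C : Set V} {w : V → V → ℝ}
    (hw : ∀ u v, w u v = w v u) (z : V × Fin 3 → ℝ) (hz : ∀ c ∈ C, z (c, 2) = 0)
    {y : V} (hy : y ∉ C) :
    (G.flowMatrix C w *ᵥ z) (y, 0) = ∑ u, G.dirMatrix w u y * z (u, 0) ∧
    (G.flowMatrix C w *ᵥ z) (y, 1) = z (y, 0) + ∑ u, G.undirMatrix w y u * z (u, 1) ∧
    (G.flowMatrix C w *ᵥ z) (y, 2) = z (y, 1) + ∑ u, G.dirMatrix w y u * z (u, 2) := by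
  classical
  have hd : ∀ u v, G.dir u v → u ≠ v := fun u v h e => G.dir_irrefl v (e ▸ h)
  have hu : ∀ u v, G.undir u v → u ≠ v := fun u v h e => G.undir_irrefl v (e ▸ h)
  simp only [Matrix.mulVec, dotProduct, Fintype.sum_prod_type, Fin.sum_univ_three, flowMatrix, Flow,
    hy, not_false_eq_true, and_true, and_false, if_false, zero_mul, add_zero, zero_add, one_mul]
  refine ⟨Finset.sum_congr rfl fun u _ => ?_, ?_, ?_⟩
  · simp only [dirMatrix]
    by_cases h : G.dir y u
    · simp [h, hd _ _ h, hw y u]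
    · simp [h]
  · rw [Finset.sum_add_distrib]
    congr 1
    · rw [Finset.sum_eq_single y] <;> simp +contextual
    · refine Finset.sum_congr rfl fun u _ => ?_
      simp only [undirMatrix]
      by_cases h : G.undir u y
      · simp [h, (hu _ _ h).symm]
      · simp [h]
  · rw [Finset.sum_add_distrib]
    congr 1
    · rw [Finset.sum_eq_single y] <;> simp +contextual
    · refine Finset.sum_congr rfl fun u _ => ?_
      simp only [dirMatrix]
      by_cases h : G.dir u y
      · by_cases hc : u ∈ C
        · simp [hz u hc]
        · simp [h, (hd _ _ h).symm, hc]
      · simp [h]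

lemma flowMatrix_mulVec_of_mem [Fintype V] {G : ChainGraph V} {C : Set V} {w : V → V → ℝ}
    (z : V × Fin 3 → ℝ) (hz : ∀ c ∈ C, z (c, 2) = 0) {y : V} (hy : y ∈ C) :
    (G.flowMatrix C w *ᵥ z) (y, 0) = z (y, 1) - ∑ u, G.undirMatrix w y u * z (u, 1) ∧
    (G.flowMatrix C w *ᵥ z) (y, 1) = - ∑ u, G.dirMatrix w y u * z (u, 2) ∧
    (G.flowMatrix C w *ᵥ z) (y, 2) = 0 := by
  classical
  have hd : ∀ u v, G.dir u v → u ≠ v := fun u v h e => G.dir_irrefl v (e ▸ h)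
  have hu : ∀ u v, G.undir u v → u ≠ v := fun u v h e => G.undir_irrefl v (e ▸ h)
  simp only [Matrix.mulVec, dotProduct, Fintype.sum_prod_type, Fin.sum_univ_three, flowMatrix, Flow,
    hy, not_true_eq_false, and_true, and_false, if_false, zero_mul, add_zero, zero_add, if_true,
    Finset.sum_const_zero, ← Finset.sum_neg_distrib]
  refine ⟨?_, Finset.sum_congr rfl fun u _ => ?_⟩
  · have hsum : z (y, 1) = ∑ u, if u = y then z (u, 1) else 0 := by simp
    rw [sub_eq_add_neg, ← Finset.sum_neg_distrib, hsum, ← Finset.sum_add_distrib]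
    refine Finset.sum_congr rfl fun u _ => ?_
    simp only [undirMatrix]
    by_cases h : u = y
    · subst h
      simp [G.undir_irrefl]
    · by_cases h' : G.undir u y
      · simp [h, h', Ne.symm h]
      · simp [h, h']
  · simp only [dirMatrix]
    by_cases h : G.dir u y
    · by_cases hc : u ∈ C
      · simp [hz u hc]
      · simp [h, (hd _ _ h).symm, hc]
    · simp [h]

/-- The solution of the flow equations gives the linear form in the conditioning variables by which
`a` has to be corrected to obtain a variable uncorrelated with them. -/
lemma concMatrix_mulVec_of_solution [Fintype V] [DecidableEq V] {G : ChainGraph V} {C : Set V}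
    {w : V → V → ℝ} (hw : ∀ u v, w u v = w v u) {a : V} (ha : a ∉ C) {z : V × Fin 3 → ℝ}
    (hz : z = Pi.single (a, 0) 1 + G.flowMatrix C w *ᵥ z) :
    (∀ c ∈ C, z (c, 2) = 0) ∧
      ∀ m ∉ C, (G.concMatrix w *ᵥ fun y => z (y, 2)) m = if m = a then 1 else 0 := by
  have hz' : ∀ i, z i = (if i = (a, 0) then 1 else 0) + (G.flowMatrix C w *ᵥ z) i := fun i => by
    conv_lhs => rw [hz]
    rw [Pi.add_apply, Pi.single_apply]
  have h2 : ∀ c ∈ C, z (c, 2) = 0 := by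
    intro c hc
    have h : ∀ j, G.flowMatrix C w (c, 2) j = 0 := by
      rintro ⟨u, l⟩
      fin_cases l <;> simp [flowMatrix, Flow, hc]
    rw [hz']
    simp [Matrix.mulVec, dotProduct, h]
  refine ⟨h2, ?_⟩
  -- Writing zₖ for z(·, k), the flow equations unfold the product defining K: z₁ = (1 - D)z₂, z₀ =
  -- (1 - U)z₁ and, outside C, (1 - D)ᵀz₀ = e_a. On C the first two equations are solved in the
  -- opposite direction, starting from z₂ = 0; hence the factor -1 in `flowMatrix`.
  have e1 : (1 - G.dirMatrix w) *ᵥ (fun y => z (y, 2)) = fun y => z (y, 1) := by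
    ext y
    rw [Matrix.sub_mulVec, Matrix.one_mulVec, Pi.sub_apply]
    simp only [Matrix.mulVec, dotProduct]
    by_cases hy : y ∈ C
    · have := hz' (y, 1)
      rw [(flowMatrix_mulVec_of_mem z h2 hy).2.1] at this
      simp only [Prod.mk.injEq, Fin.reduceEq, and_false, if_false] at this
      rw [this, h2 y hy]
      ring
    · have := hz' (y, 2)
      rw [(flowMatrix_mulVec_of_notMem hw z h2 hy).2.2] at this
      simp only [Prod.mk.injEq, Fin.reduceEq, and_false, if_false] at this
      linarith
  have e2 : (1 - G.undirMatrix w) *ᵥ (fun y => z (y, 1)) = fun y => z (y, 0) := by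
    ext y
    rw [Matrix.sub_mulVec, Matrix.one_mulVec, Pi.sub_apply]
    simp only [Matrix.mulVec, dotProduct]
    by_cases hy : y ∈ C
    · have := hz' (y, 0)
      rw [(flowMatrix_mulVec_of_mem z h2 hy).1] at this
      have hya : y ≠ a := fun h => ha (h ▸ hy)
      simp only [Prod.mk.injEq, hya, false_and, if_false] at this
      linarith
    · have := hz' (y, 1)
      rw [(flowMatrix_mulVec_of_notMem hw z h2 hy).2.1] at this
      simp only [Prod.mk.injEq, Fin.reduceEq, and_false, if_false] at this
      linarith
  intro m hm
  rw [concMatrix, ← Matrix.mulVec_mulVec, ← Matrix.mulVec_mulVec, e1, e2, Matrix.transpose_sub,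
    Matrix.transpose_one, Matrix.sub_mulVec, Matrix.one_mulVec, Pi.sub_apply]
  have := hz' (m, 0)
  rw [(flowMatrix_mulVec_of_notMem hw z h2 hm).1] at this
  simp only [Prod.mk.injEq, and_true] at this
  rw [this]
  simp [Matrix.mulVec, dotProduct]

/-! ### Weights adapted to C: contraction and nonvanishing. -/

lemma flow_of_flowMatrix_ne_zero {G : ChainGraph V} {C : Set V} {w : V → V → ℝ} {i j : V × Fin 3}
    (h : G.flowMatrix C w i j ≠ 0) : G.Flow C j i := by
  by_contra hf
  exact h (if_neg hf)

open Classical in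
/-- A rank on the states, which the steps that stay at a node and those from a node outside `C` to a
node of `C` increase. -/
noncomputable def flowRank (C : Set V) (i : V × Fin 3) : ℕ := if i.1 ∈ C then 4 - i.2 else i.2

/-- Outside C staying steps raise k, inside C they lower it. The constant 4 places the states k = 0,
1 in C, the only ones entered from outside C, above all states outside C, whose ranks are at most 2.
-/
lemma flowRank_lt {G : ChainGraph V} {C : Set V} {i j : V × Fin 3} (h : G.Flow C j i)
    (hij : i.1 = j.1 ∨ (j.1 ∉ C ∧ i.1 ∈ C)) : flowRank C j < flowRank C i := by
  obtain ⟨y, k⟩ := i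
  obtain ⟨u, l⟩ := j
  simp only [flowRank] at hij ⊢
  rcases hij with rfl | ⟨h1, h2⟩
  · have h1 := G.dir_irrefl y
    have h2 := G.undir_irrefl y
    fin_cases k <;> fin_cases l <;> simp [Flow, h1, h2] at h <;> simp [h]
  · rw [if_neg h1, if_pos h2]
    fin_cases k <;> fin_cases l <;> simp [Flow, h1, h2] at h ⊢

/-- The part of the flow that does not depend on the parameter `ζ`. -/
noncomputable def flowMatrixZero (G : ChainGraph V) (C : Set V) :
    Matrix (V × Fin 3) (V × Fin 3) ℝ :=
  open Classical in
  fun i j => if G.Flow C j i ∧ (i.1 = j.1 ∨ (j.1 ∉ C ∧ i.1 ∈ C)) then 1 else 0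

/-- The part of the flow that is proportional to the parameter `ζ`. -/
noncomputable def flowMatrixOne (G : ChainGraph V) (C : Set V) :
    Matrix (V × Fin 3) (V × Fin 3) ℝ :=
  open Classical in
  fun i j => if G.Flow C j i ∧ ¬ (i.1 = j.1 ∨ (j.1 ∉ C ∧ i.1 ∈ C)) then 1 else 0

open Classical in
/-- Edge coefficients adapted to `C`. -/
noncomputable def weight (C : Set V) (s : ℝ) (u v : V) : ℝ :=
  if u ∈ C then (if v ∈ C then s ^ 2 else s) else (if v ∈ C then s else -s ^ 2)

lemma weight_comm (C : Set V) (s : ℝ) (u v : V) : weight C s u v = weight C s v u := by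
  unfold weight
  split_ifs <;> rfl

lemma tendsto_weight (C : Set V) (u v : V) : Tendsto (fun s => weight C s u v) (𝓝 0) (𝓝 0) := by
  have : Continuous fun s : ℝ => weight C s u v := by
    unfold weight
    split_ifs <;> fun_prop
  have h := this.tendsto 0
  have h0 : weight C 0 u v = 0 := by
    unfold weight
    split_ifs <;> simp
  rwa [h0] at h

open Classical in
/-- The factors by which the flow with the coefficients `weight C s` has to be rescaled to
become a nonnegative matrix in the parameter `-s ^ 2`. -/
noncomputable def flowScale (C : Set V) (s : ℝ) (i : V × Fin 3) : ℝ := if i.1 ∈ C then -s else 1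

/-- The rescaling absorbs the factor -s of a step into C, leaving 1, and turns every other step
along an edge into -s². The sign cannot be scaled away: going into C and back out along one edge
contributes -w² whatever the symmetric weight w. -/
lemma flowMatrix_weight_mul_flowScale (G : ChainGraph V) (C : Set V) (s : ℝ) (i j : V × Fin 3) :
    G.flowMatrix C (weight C s) i j * flowScale C s j =
      flowScale C s i * (G.flowMatrixZero C + (-s ^ 2) • G.flowMatrixOne C) i j := by
  simp only [flowMatrix, flowMatrixZero, flowMatrixOne, weight, flowScale, Matrix.add_apply,
    Matrix.smul_apply, smul_eq_mul]
  by_cases h : G.Flow C j i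
  · by_cases h1 : i.1 = j.1
    · rw [h1]
      simp [h]
    · by_cases h2 : i.1 ∈ C <;> by_cases h3 : j.1 ∈ C <;> simp [h, h1, h2, h3] <;> ring
  · simp [h]

/-- At weight zero only the staying steps survive, and they raise the rank; contraction persists
nearby. The conditioning set C is arbitrary and unrelated to the set C₀ that determines the weights,
as the Markov property concerns all triples. -/
lemma eventually_isContracting [Finite V] [Fintype (V × Fin 3)] (G : ChainGraph V) (C₀ : Set V) :
    ∀ᶠ s in 𝓝 (0 : ℝ), ∀ C : Set V, (G.flowMatrix C (weight C₀ s)).IsContracting := by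
  refine eventually_all.2 fun C => ?_
  have h0 : (G.flowMatrix C fun _ _ => 0).IsContracting := by
    refine .of_rank (flowRank C) fun i j hij => ?_
    refine flowRank_lt (flow_of_flowMatrix_ne_zero hij) (Or.inl ?_)
    by_contra h
    exact hij (by simp [flowMatrix, h])
  refine h0.eventually fun i j => ?_
  simp only [flowMatrix]
  split_ifs
  · exact tendsto_const_nhds
  · exact (tendsto_weight C₀ _ _).const_mul _
  · exact (tendsto_weight C₀ _ _).const_mul _
  · exact tendsto_const_nhds

/-- For the coefficients `weight C s`, the solutions of the flow equations are nonzero at the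
reachable states. -/
lemma eventually_flow_solution_ne_zero [Fintype V] [DecidableEq V] (G : ChainGraph V) {C : Set V}
    {a b : V} (ha : a ∉ C)
    (h : Relation.ReflTransGen (G.Flow C) (a, 0) (b, 2)) :
    ∀ᶠ s in 𝓝[>] (0 : ℝ), ∀ z : V × Fin 3 → ℝ,
      z = Pi.single (a, 0) 1 + G.flowMatrix C (weight C s) *ᵥ z → z (b, 2) ≠ 0 := by
  have h1 := eventually_solution_ne_zero (N₀ := G.flowMatrixZero C) (N₁ := G.flowMatrixOne C)
    (flowRank C) (i := (a, 0)) (j := (b, 2)) ?_ ?_ ?_ ?_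
  · have ht : Tendsto (fun s : ℝ => -s ^ 2) (𝓝[>] 0) (𝓝[≠] 0) := by
      refine tendsto_nhdsWithin_iff.2 ⟨?_, ?_⟩
      · have : Continuous fun s : ℝ => -s ^ 2 := by fun_prop
        simpa using (this.tendsto 0).mono_left nhdsWithin_le_nhds
      · filter_upwards [self_mem_nhdsWithin] with s hs
        have hs : (0 : ℝ) < s := hs
        simp [hs.ne']
    filter_upwards [ht.eventually h1, self_mem_nhdsWithin] with s h2 hs z hz
    have hs : (0 : ℝ) < s := hs
    have hD : ∀ i, flowScale C s i ≠ 0 := fun i => by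
      unfold flowScale
      split_ifs <;> simp [hs.ne']
    -- Dividing z by the scale solves the rescaled system with the same source, since the scale at a
    -- ∉ C is 1.
    have h3 := h2 (fun i => z i / flowScale C s i) ?_
    · intro h4
      exact h3 (by simp [h4])
    · ext i
      have hzi : z i = (Pi.single (a, 0) 1 : V × Fin 3 → ℝ) i +
          ∑ j, G.flowMatrix C (weight C s) i j * z j := by
        conv_lhs => rw [hz]
        rfl
      rw [div_eq_iff (hD i), hzi, Pi.add_apply, add_mul]
      congr 1
      · by_cases hi : i = (a, 0)
        · subst hi
          simp [flowScale, ha]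
        · simp [hi]
      · simp only [Matrix.mulVec, dotProduct]
        rw [Finset.sum_mul]
        refine Finset.sum_congr rfl fun j _ => ?_
        have := flowMatrix_weight_mul_flowScale G C s i j
        generalize (G.flowMatrixZero C + (-s ^ 2) • G.flowMatrixOne C) i j = q at this ⊢
        generalize G.flowMatrix C (weight C s) i j = n at this ⊢
        have hDj := hD j
        field_simp
        linear_combination z j * this
  · intro i j hij
    have : G.Flow C j i ∧ (i.1 = j.1 ∨ (j.1 ∉ C ∧ i.1 ∈ C)) := by
      by_contra hf
      exact hij (if_neg hf)
    exact flowRank_lt this.1 this.2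
  · intro i j
    unfold flowMatrixZero
    split_ifs <;> simp
  · intro i j
    unfold flowMatrixOne
    split_ifs <;> simp
  · refine Relation.ReflTransGen.mono (fun k l hkl => ?_) _ _ h
    unfold flowMatrixZero flowMatrixOne
    by_cases h' : l.1 = k.1 ∨ (k.1 ∉ C ∧ l.1 ∈ C) <;> simp [hkl, h']

/-- Diagonal dominance: by the inequality between geometric and arithmetic means, xᵀUx is at most
the sum of |w u v| x_u², and each row sum of |w| is at most 1. -/
lemma posSemidef_one_sub_undirMatrix [Fintype V] [DecidableEq V] (G : ChainGraph V)
    {w : V → V → ℝ} (hw : ∀ u v, w u v = w v u) (h : ∀ u v, |w u v| * Fintype.card V ≤ 1) :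
    (1 - G.undirMatrix w).PosSemidef := by
  have hsymm : ∀ u v, G.undirMatrix w u v = G.undirMatrix w v u := fun u v => by
    simp only [undirMatrix, hw u v]
    congr 1
    exact propext ⟨G.undir_symm _ _, G.undir_symm _ _⟩
  have habs : ∀ u v, |G.undirMatrix w u v| ≤ |w u v| := fun u v => by
    simp only [undirMatrix]
    split_ifs <;> simp
  refine Matrix.PosSemidef.of_dotProduct_mulVec_nonneg ?_ fun x => ?_
  · ext u v
    simp [Matrix.one_apply, hsymm u v, eq_comm]
  · rw [Matrix.sub_mulVec, Matrix.one_mulVec, dotProduct_sub, sub_nonneg, star_trivial]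
    simp only [Matrix.mulVec, dotProduct, Finset.mul_sum]
    have hle : ∀ u v, x u * (G.undirMatrix w u v * x v) ≤
        |w u v| * (x u * x u) / 2 + |w v u| * (x v * x v) / 2 := by
      intro u v
      rw [hw v u, ← add_div, ← mul_add]
      calc x u * (G.undirMatrix w u v * x v) ≤ |x u * (G.undirMatrix w u v * x v)| := le_abs_self _
        _ = |G.undirMatrix w u v| * (|x u| * |x v|) := by rw [abs_mul, abs_mul]; ring
        _ ≤ |w u v| * ((x u * x u + x v * x v) / 2) := by
            refine mul_le_mul (habs u v) ?_ (by positivity) (abs_nonneg _)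
            rw [← abs_mul_abs_self (x u), ← abs_mul_abs_self (x v)]
            nlinarith [sq_nonneg (|x u| - |x v|)]
        _ = _ := by ring
    calc ∑ u, ∑ v, x u * (G.undirMatrix w u v * x v)
        ≤ ∑ u, ∑ v, (|w u v| * (x u * x u) / 2 + |w v u| * (x v * x v) / 2) :=
          Finset.sum_le_sum fun u _ => Finset.sum_le_sum fun v _ => hle u v
      _ = ∑ u, ∑ v, |w u v| * (x u * x u) := by
          simp only [Finset.sum_add_distrib]
          rw [Finset.sum_comm (f := fun u v => |w v u| * (x v * x v) / 2),
            ← Finset.sum_add_distrib]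
          refine Finset.sum_congr rfl fun u _ => ?_
          rw [← Finset.sum_add_distrib]
          refine Finset.sum_congr rfl fun v _ => ?_
          ring
      _ ≤ ∑ u, x u * x u := by
          refine Finset.sum_le_sum fun u _ => ?_
          rw [← Finset.sum_mul]
          refine mul_le_of_le_one_left (mul_self_nonneg _) ?_
          have hn : 0 < (Fintype.card V : ℝ) := by
            have : Nonempty V := ⟨u⟩
            exact_mod_cast Fintype.card_pos
          calc ∑ v, |w u v| ≤ ∑ _v : V, 1 / (Fintype.card V : ℝ) :=
                Finset.sum_le_sum fun v _ => (le_div_iff₀ hn).2 (h u v)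
            _ = 1 := by
                rw [Finset.sum_const, nsmul_eq_mul, Finset.card_univ]
                field_simp

end ChainGraph

/-! ### Gaussian vectors: conditional independence through covariances of residuals. -/

section Gaussian

variable {V : Type*} [Fintype V]

lemma exists_gaussian_of_posSemidef [DecidableEq V] {S : Matrix V V ℝ} (hS : S.PosSemidef) :
    ∃ p : ProbabilityMeasure (V → ℝ), HasGaussianLaw id (p : Measure (V → ℝ)) ∧
      (∀ i, ∫ x, x i ∂(p : Measure (V → ℝ)) = 0) ∧
      ∀ i j, cov[fun x => x i, fun x => x j; (p : Measure (V → ℝ))] = S i j := by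
  let e := PiLp.continuousLinearEquiv 2 ℝ (fun _ : V => ℝ)
  have he : Measurable (e : EuclideanSpace ℝ V → V → ℝ) := e.continuous.measurable
  let ν := multivariateGaussian (0 : EuclideanSpace ℝ V) S
  have : IsProbabilityMeasure (ν.map e) := Measure.isProbabilityMeasure_map he.aemeasurable
  refine ⟨⟨ν.map e, this⟩, ?_, fun i => ?_, fun i j => ?_⟩
  · have : IsGaussian (ν.map (e : EuclideanSpace ℝ V →L[ℝ] V → ℝ)) := inferInstance
    exact ⟨by rw [Measure.map_id]; exact this⟩
  · rw [ProbabilityMeasure.coe_mk, integral_map he.aemeasurable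
      (measurable_pi_apply i).aestronglyMeasurable]
    have h1 := (EuclideanSpace.proj (𝕜 := ℝ) i).integral_comp_id_comm
      (μ := ν) IsGaussian.integrable_id
    rw [integral_id_multivariateGaussian] at h1
    change ∫ x : EuclideanSpace ℝ V, x i ∂ν = 0
    simpa using h1
  · rw [ProbabilityMeasure.coe_mk, covariance_map_fun (measurable_pi_apply i).aestronglyMeasurable
      (measurable_pi_apply j).aestronglyMeasurable he.aemeasurable]
    exact covariance_eval_multivariateGaussian hS i j

variable {P : Measure (V → ℝ)}

lemma ProbabilityTheory.HasGaussianLaw.covariance_sum_mul_eval [IsProbabilityMeasure P]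
    (hP : HasGaussianLaw id P) (k : V → ℝ) (v : V) :
    cov[fun x => ∑ u, k u * x u, fun x => x v; P] =
      ∑ u, k u * cov[fun x => x u, fun x => x v; P] := by
  have h2 : ∀ u, MemLp (fun x : V → ℝ => x u) 2 P := fun u =>
    (HasGaussianLaw.eval (X := fun i (x : V → ℝ) => x i) hP u).memLp_two
  rw [covariance_fun_sum_left (fun u => (h2 u).const_mul (k u)) (h2 v)]
  exact Finset.sum_congr rfl fun u _ => covariance_const_mul_left _

lemma measurable_coordProj {V : Type*} (C : Set V) : Measurable (coordProj C) :=
  measurable_pi_lambda _ fun i : C => measurable_pi_apply (i : V)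

/-- A linear combination of the coordinates of a Gaussian vector is independent of those coordinates
with which it is uncorrelated. -/
lemma ProbabilityTheory.HasGaussianLaw.indepFun_sum_mul_coordProj (hP : HasGaussianLaw id P)
    {ι : Type*} [Finite ι] (k : ι → V → ℝ) (D : Set V)
    (h : ∀ i, ∀ d ∈ D, ∑ u, k i u * cov[fun x => x u, fun x => x d; P] = 0) :
    IndepFun (fun x i => ∑ u, k i u * x u) (coordProj D) P := by
  have := hP.isProbabilityMeasure
  have := Fintype.ofFinite ι
  have := Fintype.ofFinite D
  refine HasGaussianLaw.indepFun_of_covariance_eval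
    (X := fun i (x : V → ℝ) => ∑ u, k i u * x u) (Y := fun (d : D) (x : V → ℝ) => x d) ?_
    fun i d => (hP.covariance_sum_mul_eval (k i) d).trans (h i d d.2)
  let L : (V → ℝ) →L[ℝ] (ι → ℝ) × (D → ℝ) :=
    (ContinuousLinearMap.pi fun i => ∑ u, k i u • ContinuousLinearMap.proj u).prod
      (ContinuousLinearMap.pi fun d => ContinuousLinearMap.proj (d : V))
  refine (hP.map_fun L).congr (ae_of_all _ fun x => ?_)
  exact Prod.ext (funext fun i => by simp [L]) (funext fun d => by simp [L])

/-- If the linear forms `k a` express residuals of the coordinates in `A` after a regression on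
those in `C`, and they are uncorrelated with the coordinates in `B`, then the coordinates in `A` and
`B` are conditionally independent given those in `C`. -/
lemma ProbabilityTheory.HasGaussianLaw.condIndepFun_coordProj [IsProbabilityMeasure P]
    (hP : HasGaussianLaw id P)
    {A B C : Set V} (k : V → V → ℝ)
    (hk : ∀ a ∈ A, ∀ x : V → ℝ, ∀ z : V → ℝ, (∀ c ∈ C, z c = x c) → (∀ m ∉ C, z m = 0) →
      ∑ u, k a u * x u = x a + ∑ u, k a u * z u)
    (hB : ∀ a ∈ A, ∀ b ∈ B, ∑ u, k a u * cov[fun x => x u, fun x => x b; P] = 0)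
    (hC : ∀ a ∈ A, ∀ c ∈ C, ∑ u, k a u * cov[fun x => x u, fun x => x c; P] = 0) :
    CondIndepFun (coordSigma C) (coordSigma_le C) (coordProj A) (coordProj B) P := by
  classical
  -- For jointly Gaussian vectors zero covariance means independence, so the residuals are
  -- independent of the coordinates in B and C jointly.
  have hind := hP.indepFun_sum_mul_coordProj (fun (a : A) => k a) (B ∪ C) (by
    rintro ⟨a, ha⟩ d (hd | hd)
    · exact hB a ha d hd
    · exact hC a ha d hd)
  have hind' := hind.comp measurable_id
    (ψ := fun y : ↑(B ∪ C) → ℝ => ((fun b : B => y ⟨b, Or.inl b.2⟩), fun c : C => y ⟨c, Or.inr c.2⟩))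
    (by fun_prop)
  -- Recovers the coordinates in A from their residuals and the coordinates in C.
  let φ : (A → ℝ) × (C → ℝ) → A → ℝ := fun q a =>
    q.1 a - ∑ u, k a u * (if h : u ∈ C then q.2 ⟨u, h⟩ else 0)
  have hφ : Measurable φ := by
    refine measurable_pi_lambda _ fun a => ?_
    refine Measurable.sub (by fun_prop) (Finset.measurable_sum _ fun u _ => ?_)
    split_ifs <;> fun_prop
  have h := condIndepFun_of_indepFun_prodMk (μ := P) (Y := coordProj B) (Z := coordProj C)
    (by fun_prop) (measurable_coordProj B) (measurable_coordProj C) hind' hφ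
  convert h using 1
  ext x a
  have := hk a a.2 x (fun u => if u ∈ C then x u else 0) (fun c hc => by simp [hc])
    (fun m hm => by simp [hm])
  simp only [φ, Function.comp_apply, id_eq, this, coordProj, dite_eq_ite]
  ring

/-- If the coordinates in `A` and `B` are conditionally independent given those in `C`, then the
residual of a coordinate in `A` after a regression on the coordinates in `C` is uncorrelated with
the coordinates in `B`. -/
lemma ProbabilityTheory.HasGaussianLaw.sum_mul_covariance_eq_zero [IsProbabilityMeasure P]
    (hP : HasGaussianLaw id P) (h0 : ∀ i, ∫ x, x i ∂P = 0)
    {A B C : Set V} (h : CondIndepFun (coordSigma C) (coordSigma_le C) (coordProj A) (coordProj B) P)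
    {a b : V} (ha : a ∈ A) (hb : b ∈ B) (k : V → ℝ)
    (hk : ∀ x : V → ℝ, ∀ z : V → ℝ, (∀ c ∈ C, z c = x c) → (∀ m ∉ C, z m = 0) →
      ∑ u, k u * x u = x a + ∑ u, k u * z u)
    (hC : ∀ c ∈ C, ∑ u, k u * cov[fun x => x u, fun x => x c; P] = 0) :
    ∑ u, k u * cov[fun x => x u, fun x => x b; P] = 0 := by
  classical
  have h2 : ∀ u, MemLp (fun x : V → ℝ => x u) 2 P := fun u =>
    (HasGaussianLaw.eval (X := fun i (x : V → ℝ) => x i) hP u).memLp_two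
  have hab : CondIndepFun (coordSigma C) (coordSigma_le C) (fun x : V → ℝ => x a) (fun x => x b) P :=
    h.comp (φ := fun y : A → ℝ => y ⟨a, ha⟩) (ψ := fun y : B → ℝ => y ⟨b, hb⟩) (by fun_prop)
      (by fun_prop)
  let L : (V → ℝ) → ℝ := fun x => ∑ u, k u * (if u ∈ C then x u else 0)
  have hL : Measurable[coordSigma C] L := by
    have : L = (fun y : C → ℝ => ∑ u, k u * (if h : u ∈ C then y ⟨u, h⟩ else 0)) ∘ coordProj C := by
      ext x
      simp only [L, Function.comp_apply, coordProj, dite_eq_ite]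
    rw [this]
    refine Measurable.comp ?_ (comap_measurable _)
    refine Finset.measurable_sum _ fun u _ => ?_
    split_ifs <;> fun_prop
  have hL2 : MemLp L 2 P := by
    refine memLp_finsetSum _ fun u _ => MemLp.const_mul ?_ _
    split_ifs
    · exact h2 u
    · exact MemLp.zero
  have hR : (fun x : V → ℝ => x a) + L = fun x => ∑ u, k u * x u := by
    ext x
    rw [hk x (fun u => if u ∈ C then x u else 0) (fun c hc => by simp [hc])
      (fun m hm => by simp [hm])]
    rfl
  have hR0 : ∫ x, ∑ u, k u * x u ∂P = 0 := by
    rw [integral_finsetSum _ fun u _ => ((h2 u).integrable one_le_two).const_mul _]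
    simp [integral_const_mul, h0]
  have hind : Indep (MeasurableSpace.comap (fun x : V → ℝ => ∑ u, k u * x u) inferInstance)
      (coordSigma C) P := by
    have := hP.indepFun_sum_mul_coordProj (fun _ : Unit => k) C fun _ => hC
    exact this.comp (φ := fun y : Unit → ℝ => y ()) (by fun_prop) measurable_id
  have key := hab.integral_residual_mul_eq_zero (by fun_prop) (by fun_prop) hL (h2 a) (h2 b) hL2
    (by rw [hR]; exact hind) (by rw [hR]; exact hR0)
  rw [hR] at key
  rw [← hP.covariance_sum_mul_eval, covariance_eq_sub ?_ (h2 b), hR0, zero_mul, sub_zero]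
  · exact key
  · exact memLp_finsetSum _ fun u _ => (h2 u).const_mul _

end Gaussian

/-! ### The witnessing distribution and the theorem. -/

namespace ChainGraph

variable {V : Type*}

/-- A linear form whose coefficients outside `C` are those of the coordinate `a` differs from this
coordinate by a linear form in the coordinates in `C`. -/
lemma sum_mul_eq_add_sum_mul [Fintype V] [DecidableEq V] {C : Set V} {a : V} {k : V → ℝ}
    (ha : a ∉ C) (hk : ∀ m ∉ C, k m = if m = a then 1 else 0) {x z : V → ℝ}
    (hz : ∀ c ∈ C, z c = x c) (hz' : ∀ m ∉ C, z m = 0) :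
    ∑ u, k u * x u = x a + ∑ u, k u * z u := by
  have : x a = ∑ u, if u = a then x u else 0 := by simp
  rw [this, ← Finset.sum_add_distrib]
  refine Finset.sum_congr rfl fun u _ => ?_
  by_cases hu : u ∈ C
  · have hua : u ≠ a := fun h => ha (h ▸ hu)
    rw [hz u hu, if_neg hua, zero_add]
  · rw [hk u hu, hz' u hu]
    split_ifs <;> simp

/-- With empty conditioning set, the solution with source (a, 0) satisfies K z₂ = e_a, so all basis
vectors are in the range of K. -/
lemma isUnit_concMatrix [Fintype V] [DecidableEq V] (G : ChainGraph V) {w : V → V → ℝ}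
    (hw : ∀ u v, w u v = w v u) (h : (G.flowMatrix ∅ w).IsContracting) :
    IsUnit (G.concMatrix w) := by
  rw [← Matrix.mulVec_surjective_iff_isUnit]
  choose z hz using fun a : V => h.exists_solution (Pi.single (a, 0) 1)
  intro f
  refine ⟨∑ a, f a • fun y => z a (y, 2), ?_⟩
  rw [Matrix.mulVec_sum]
  ext m
  rw [Finset.sum_apply]
  simp only [Matrix.mulVec_smul, Pi.smul_apply, smul_eq_mul]
  have : ∀ a, (G.concMatrix w *ᵥ fun y => z a (y, 2)) m = if m = a then 1 else 0 := fun a =>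
    (concMatrix_mulVec_of_solution hw (Set.notMem_empty a) (hz a)).2 m (Set.notMem_empty m)
  simp [this]

/-- Weak completeness of the separation criterion: an open route between `a` and `b` is witnessed by
a Markovian distribution in which `a` and `b` are dependent. -/
theorem exists_isMarkovian_notMem_distIndependences [Finite V] (G : ChainGraph V) {A B C : Set V}
    (hAC : Disjoint A C) (hBC : Disjoint B C) {a b : V} (ha : a ∈ A) (hb : b ∈ B)
    (ρ : G.Route a b) (hρ : G.IsOpenRoute ρ C) :
    ∃ p : ProbabilityMeasure (V → ℝ), G.IsMarkovian p ∧ (A, B, C) ∉ distIndependences p := by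
  classical
  have := Fintype.ofFinite V
  have haC : a ∉ C := hAC.notMem_of_mem_left ha
  have hbC : b ∉ C := hBC.notMem_of_mem_left hb
  have hreach := (reachable_iff_exists_openRoute haC hbC).2 ⟨ρ, hρ⟩
  have hsmall : ∀ᶠ s in 𝓝 (0 : ℝ), ∀ u v, |weight C s u v| * Fintype.card V ≤ 1 := by
    refine eventually_all.2 fun u => eventually_all.2 fun v => ?_
    have : Tendsto (fun s => |weight C s u v| * Fintype.card V) (𝓝 0) (𝓝 0) := by
      simpa using (tendsto_weight C u v).abs.mul_const (Fintype.card V : ℝ)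
    exact (this.eventually_lt_const one_pos).mono fun _ h => h.le
  -- One small s > 0 serves three purposes: a semidefinite K, contraction for every conditioning
  -- set, and a nonzero solution at (b, 2) for the given C.
  obtain ⟨s, hs1, hs2, hs3⟩ := ((hsmall.filter_mono nhdsWithin_le_nhds).and
    (((G.eventually_isContracting C).filter_mono nhdsWithin_le_nhds).and
      (G.eventually_flow_solution_ne_zero haC hreach))).exists
  set w := weight C s
  have hw : ∀ u v, w u v = w v u := weight_comm C s
  have hK := G.isUnit_concMatrix hw (hs2 ∅)
  have hS : (G.concMatrix w)⁻¹.PosSemidef := by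
    refine Matrix.PosSemidef.inv ?_
    have := (G.posSemidef_one_sub_undirMatrix hw hs1).conjTranspose_mul_mul_same
      (1 - G.dirMatrix w)
    rwa [Matrix.conjTranspose_eq_transpose_of_trivial] at this
  obtain ⟨p, hp, hp0, hcov⟩ := exists_gaussian_of_posSemidef hS
  -- Take k = K z₂. Since the covariance matrix is K⁻¹, the covariances of the form k · x with the
  -- coordinates are z₂; outside D the coefficients are those of X_c, so k · x is its residual.
  have hres : ∀ (D : Set V) (c : V), c ∉ D → ∃ z : V × Fin 3 → ℝ,
      z = Pi.single (c, 0) 1 + G.flowMatrix D w *ᵥ z ∧ (∀ d ∈ D, z (d, 2) = 0) ∧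
      ∃ k : V → ℝ, (∀ m ∉ D, k m = if m = c then 1 else 0) ∧ ∀ v,
        ∑ u, k u * cov[fun x => x u, fun x => x v; (p : Measure (V → ℝ))] = z (v, 2) := by
    intro D c hc
    obtain ⟨z, hz⟩ := (hs2 D).exists_solution (Pi.single (c, 0) 1)
    obtain ⟨h1, h2⟩ := concMatrix_mulVec_of_solution hw hc hz
    refine ⟨z, hz, h1, _, h2, fun v => ?_⟩
    have h3 : (G.concMatrix w)⁻¹ *ᵥ (G.concMatrix w *ᵥ fun y => z (y, 2)) = fun y => z (y, 2) := by
      rw [Matrix.mulVec_mulVec, Matrix.nonsing_inv_mul _ ((Matrix.isUnit_iff_isUnit_det _).1 hK),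
        Matrix.one_mulVec]
    refine Eq.trans ?_ (congrFun h3 v)
    refine Finset.sum_congr rfl fun u _ => ?_
    rw [covariance_comm, hcov, mul_comm]
  refine ⟨p, ?_, ?_⟩
  · rintro ⟨A', B', C'⟩ ⟨hAB', hAC', hBC', hsep⟩
    refine ⟨hAB', hAC', hBC', ?_⟩
    simp only at hAB' hAC' hBC' hsep ⊢
    choose! z hz hz0 k hk hkz using fun c (hc : c ∉ C') => hres C' c hc
    have hA : ∀ c ∈ A', c ∉ C' := fun c hc => hAC'.notMem_of_mem_left hc
    refine hp.condIndepFun_coordProj k (fun c hc x y hy hy' =>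
      sum_mul_eq_add_sum_mul (hA c hc) (hk c (hA c hc)) hy hy') (fun c hc d hd => ?_)
      (fun c hc d hd => ?_)
    · rw [hkz c (hA c hc)]
      have hdC : d ∉ C' := hBC'.notMem_of_mem_left hd
      -- Separation makes (d, 2) unreachable, so the partial covariance vanishes.
      refine (hs2 C').eq_zero_of_not_mem (hz c (hA c hc))
        {i | Relation.ReflTransGen (G.Flow C') (c, 0) i} (fun i hi => ?_)
        (fun i j hij hj => Relation.ReflTransGen.tail hj (flow_of_flowMatrix_ne_zero hij))
        (fun hr => hsep c hc d hd ((reachable_iff_exists_openRoute (hA c hc) hdC).1 hr))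
      have : i ≠ (c, 0) := fun h => hi (h ▸ Relation.ReflTransGen.refl)
      simp [this]
    · rw [hkz c (hA c hc)]
      exact hz0 c (hA c hc) d hd
  · rintro ⟨-, -, -, hci⟩
    obtain ⟨z, hz, hz0, k, hk, hkz⟩ := hres C a haC
    refine hs3 z hz ?_
    rw [← hkz]
    exact hp.sum_mul_covariance_eq_zero hp0 hci ha hb k
      (fun x y hy hy' => sum_mul_eq_add_sum_mul haC hk hy hy')
      (fun c hc => (hkz c).trans (hz0 c hc))

lemma MarkovEquivalent.independences_subset [Finite V] {G H : ChainGraph V}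
    (h : G.MarkovEquivalent H) : G.independences ⊆ H.independences := by
  rintro ⟨A, B, C⟩ hG
  obtain ⟨hAB, hAC, hBC, -⟩ := id hG
  refine ⟨hAB, hAC, hBC, ?_⟩
  rintro a ha b hb ⟨ρ, hρ⟩
  -- An open route in H yields a distribution Markovian for H, hence for G, that violates an
  -- independence of G.
  obtain ⟨p, hp, hne⟩ := H.exists_isMarkovian_notMem_distIndependences hAC hBC ha hb ρ hρ
  have hpG : G.IsMarkovian p := (Set.ext_iff.1 h p).2 hp
  exact hne (hpG hG)

end ChainGraph

theorem lemma1 {V : Type*} [Finite V] (G H : ChainGraph V) :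
    G.MarkovEquivalent H ↔ G.independences = H.independences := by
  refine ⟨fun h => ?_, fun h => ?_⟩
  · exact h.independences_subset.antisymm (ChainGraph.MarkovEquivalent.independences_subset h.symm)
  · simp only [ChainGraph.MarkovEquivalent, ChainGraph.IsMarkovian, h]
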